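/- Let $a_1,\dots,a_k$ be positive integers with sum $N$. The integer $(a_1+\dots+a_k)!/(a_1!\cdots a_k!)$ is called a proper $k$-nomial coefficient of weight $N$ (a proper trinomial coefficient when $k=3$). Wasserman's conjecture states that for every $k>1$ every family of $k$ proper $k$-nomial coefficients of equal weight $N$ has a common divisor $>1$. There is no counterexample to this conjecture for $k=3$ with $N<785$; that is, for every $N<785$, any three (not necessarily distinct) proper trinomial coefficients of weight $N$ have a common divisor $>1$. -/

import Mathlib

/-- `c` is a proper `k`-nomial coefficient of weight `N`: it equals
`(a₁ + ⋯ + aₖ)! / (a₁! ⋯ aₖ!)` for some positive integers `a₁, …, aₖ` with sum `N`. -/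
def IsProperNomialCoeff (k N c : ℕ) : Prop :=
  ∃ a : Fin k → ℕ, (∀ i, 0 < a i) ∧ ∑ i, a i = N ∧ c = Nat.multinomial Finset.univ a

/-- A counterexample of weight `N` to Wasserman's conjecture for `k`: a family of `k` proper
`k`-nomial coefficients (not necessarily distinct) of weight `N` with no common divisor `> 1`. -/
def IsWassermanCounterexample (k N : ℕ) (c : Fin k → ℕ) : Prop :=
  (∀ j, IsProperNomialCoeff k N (c j)) ∧ ¬ ∃ d : ℕ, 1 < d ∧ ∀ j, d ∣ c j

/-! Attach to each weight `N` a nonempty list of primes such that every proper trinomial coefficient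
of weight `N` fails to be divisible by at most `m` entries, where `3 * m` is less than the length.
Three coefficients then miss fewer entries than there are, so some prime divides all three.

The attached property is a finite check. A trinomial coefficient is a product of two binomials, and
by Lucas a prime `p` not dividing `n.choose a` forces each base `p` digit of `a` to be at most that
of `n`. A coefficient missing more than `m` entries misses one beyond the first `m`, so it suffices
to run through the carry-free splittings of `N` for those primes. Such splittings are rare, which
makes the search feasible in the kernel. -/

/-- A multinomial coefficient with three parts depends only on the parts up to order, and equals
a product of two binomial coefficients. -/
theorem exists_sorted_of_isProperNomialCoeff_three {N c : ℕ} (h : IsProperNomialCoeff 3 N c) :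
    ∃ x y : ℕ, 0 < x ∧ x ≤ y ∧ y ≤ N - x - y ∧ c = N.choose x * (N - x).choose y := by
  obtain ⟨a, ha, hs, rfl⟩ := h
  have hspec := Nat.multinomial_spec Finset.univ a
  rw [hs] at hspec
  simp only [Fin.sum_univ_three, Fin.prod_univ_three] at hs hspec
  have key : ∀ x y z : ℕ, 0 < x → x ≤ y → y ≤ z → x + y + z = N →
      x.factorial * y.factorial * z.factorial
        = (a 0).factorial * (a 1).factorial * (a 2).factorial →
      ∃ x y : ℕ, 0 < x ∧ x ≤ y ∧ y ≤ N - x - y ∧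
        Nat.multinomial Finset.univ a = N.choose x * (N - x).choose y := by
    intro x y z hx hxy hyz hsum hprod
    refine ⟨x, y, hx, hxy, by omega, ?_⟩
    have h1 := Nat.choose_mul_factorial_mul_factorial (n := N) (k := x) (by omega)
    have h2 := Nat.choose_mul_factorial_mul_factorial (n := N - x) (k := y) (by omega)
    have h3 : N - x - y = z := by omega
    rw [h3] at h2
    rw [← hprod] at hspec
    have hpos : 0 < x.factorial * y.factorial * z.factorial := by positivity
    refine Nat.eq_of_mul_eq_mul_left hpos ?_
    rw [hspec, ← h1, ← h2]
    ring
  have h0 := ha 0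
  have h1 := ha 1
  have h2 := ha 2
  rcases le_total (a 0) (a 1) with h01 | h01 <;> rcases le_total (a 1) (a 2) with h12 | h12 <;>
    rcases le_total (a 0) (a 2) with h02 | h02
  · exact key (a 0) (a 1) (a 2) h0 h01 h12 (by omega) (by ring)
  · exact key (a 0) (a 1) (a 2) h0 h01 h12 (by omega) (by ring)
  · exact key (a 0) (a 2) (a 1) h0 h02 h12 (by omega) (by ring)
  · exact key (a 2) (a 0) (a 1) h2 h02 h01 (by omega) (by ring)
  · exact key (a 1) (a 0) (a 2) h1 h01 h02 (by omega) (by ring)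
  · exact key (a 1) (a 2) (a 0) h1 h12 h02 (by omega) (by ring)
  · exact key (a 2) (a 1) (a 0) h2 h12 h01 (by omega) (by ring)
  · exact key (a 2) (a 1) (a 0) h2 h12 h01 (by omega) (by ring)

/-- Application to a natural number that is evaluated first when the kernel reduces. -/
def applyStrict (f : ℕ → Bool) : ℕ → Bool
  | 0 => f 0
  | n + 1 => f (n + 1)

theorem applyStrict_eq (f : ℕ → Bool) (n : ℕ) : applyStrict f n = f n := by
  cases n <;> rfl

/-- Whether `f` holds at all `d ≤ r`. -/
def allLe (f : ℕ → Bool) : ℕ → Bool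
  | 0 => f 0
  | r + 1 => f (r + 1) && allLe f r

theorem allLe_apply {f : ℕ → Bool} {d : ℕ} : ∀ {r : ℕ}, allLe f r = true → d ≤ r → f d = true
  | 0, h, hd => by
    obtain rfl : d = 0 := by omega
    exact h
  | r + 1, h, hd => by
    simp only [allLe, Bool.and_eq_true] at h
    rcases Nat.lt_or_ge r d with hlt | hge
    · obtain rfl : d = r + 1 := by omega
      exact h.1
    · exact allLe_apply h.2 hge

/-! ### Non-divisibility of binomials through digits -/

/-- Digitwise comparison: whether each of the last `k` digits of `a` in base `p` is at most the
corresponding digit of `n`. -/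
def digitsLe (p : ℕ) : ℕ → ℕ → ℕ → Bool
  | 0, _, _ => true
  -- Stopping at `n = 0` may accept an `a` with further nonzero digits. This is harmless: wrong
  -- acceptance only raises the count of possible non-divisors.
  | k + 1, n, a => Nat.ble (Nat.mod a p) (Nat.mod n p) &&
      (Nat.beq n 0 || digitsLe p k (Nat.div n p) (Nat.div a p))

/-- Whether `f` holds at all numbers whose base `p` digits are at most those of `n`, where `n` is
supposed to have at most `k` digits. -/
def allDigitsLe (p : ℕ) : ℕ → ℕ → (ℕ → Bool) → Bool
  | 0, _, f => f 0
  | k + 1, n, f => bif Nat.beq n 0 then f 0 else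
      allLe (fun d => allDigitsLe p k (Nat.div n p) fun b => f (Nat.add d (Nat.mul p b)))
        (Nat.mod n p)

/-- Lucas's congruence; a last digit of `a` exceeding that of `n` would make the binomial vanish
modulo `p`. -/
theorem not_dvd_choose_mod_div {p n a : ℕ} (hp : p.Prime) (h : ¬ p ∣ n.choose a) :
    a % p ≤ n % p ∧ ¬ p ∣ (n / p).choose (a / p) := by
  have := Fact.mk hp
  have hmod : n.choose a ≡ (n % p).choose (a % p) * (n / p).choose (a / p) [MOD p] :=
    Choose.choose_modEq_choose_mod_mul_choose_div_nat
  rw [hmod.dvd_iff dvd_rfl] at h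
  constructor
  · by_contra hlt
    rw [Nat.choose_eq_zero_of_lt (by omega)] at h
    simp at h
  · exact fun hd => h (hd.mul_left _)

theorem digitsLe_of_not_dvd_choose {p : ℕ} (hp : p.Prime) :
    ∀ {k n a : ℕ}, ¬ p ∣ n.choose a → digitsLe p k n a = true
  | 0, _, _, _ => rfl
  | k + 1, n, a, h => by
    obtain ⟨h1, h2⟩ := not_dvd_choose_mod_div hp h
    simp only [digitsLe, Bool.and_eq_true, Bool.or_eq_true]
    exact ⟨Nat.ble_eq_true_of_le h1, Or.inr (digitsLe_of_not_dvd_choose hp h2)⟩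

/-- Soundness of the enumeration. Here the fuel matters: `n < 2 ^ k` and `2 ≤ p` ensure that `k`
digits exhaust `n`. -/
theorem apply_of_allDigitsLe {p : ℕ} (hp : p.Prime) :
    ∀ {k n a : ℕ} {f : ℕ → Bool}, n < 2 ^ k → allDigitsLe p k n f = true → ¬ p ∣ n.choose a →
      f a = true := by
  have zero : ∀ {a : ℕ}, ¬ p ∣ (0 : ℕ).choose a → a = 0 := by
    intro a h
    by_contra ha
    rw [Nat.choose_eq_zero_of_lt (by omega)] at h
    simp at h
  intro k
  induction k with
  | zero =>
    intro n a f hn h hd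
    obtain rfl : n = 0 := by simpa using hn
    rw [zero hd]
    exact h
  | succ k ih =>
    intro n a f hn h hd
    rcases Nat.eq_zero_or_pos n with rfl | hpos
    · rw [zero hd]
      exact h
    · have hb : Nat.beq n 0 = false := by
        cases n with
        | zero => omega
        | succ n => rfl
      simp only [allDigitsLe, hb, cond_false] at h
      obtain ⟨h1, h2⟩ := not_dvd_choose_mod_div hp hd
      have hdiv : n / p < 2 ^ k := by
        rw [Nat.div_lt_iff_lt_mul hp.pos]
        calc n < 2 ^ (k + 1) := hn
          _ = 2 ^ k * 2 := pow_succ _ _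
          _ ≤ 2 ^ k * p := Nat.mul_le_mul_left _ hp.two_le
      have h3 := ih hdiv (allLe_apply h h1) h2
      have h4 : Nat.add (a % p) (Nat.mul p (a / p)) = a := Nat.mod_add_div a p
      rwa [h4] at h3

/-! ### Counting the primes that miss a coefficient -/

/-- The number of entries `q` of a list for which no carry shows that `q` divides the trinomial
coefficient of weight `N` with parts `x`, `y`, `N - x - y`. -/
def nonDivisorBound (N x y : ℕ) : List ℕ → ℕ
  | [] => 0
  | q :: H => bif digitsLe q 10 N x && digitsLe q 10 (Nat.sub N x) y
      then Nat.succ (nonDivisorBound N x y H) else nonDivisorBound N x y H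

/-- Trial division; correct for `p < 841 = 29 ^ 2`. -/
def isSmallPrime (p : ℕ) : Bool :=
  Nat.ble 2 p && Nat.ble p 840 &&
    allLe (fun d => Nat.ble p (Nat.add d 2) || !Nat.beq (Nat.mod p (Nat.add d 2)) 0) 27

/-- Whether all entries of `H` are primes and every proper trinomial coefficient of weight `N` is
divisible by all but at most `m` of them. A coefficient that violates the latter is not divisible
by some entry after the first `m`. -/
def fewNonDivisors (N m : ℕ) (H : List ℕ) : Bool :=
  H.all isSmallPrime && (H.drop m).all fun p =>
    allDigitsLe p 10 N (applyStrict fun x =>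
      Nat.beq x 0 || Nat.blt N (Nat.mul 3 x) ||
        allDigitsLe p 10 (Nat.sub N x) (applyStrict fun y =>
          Nat.blt y x || Nat.blt (Nat.sub N x) (Nat.mul 2 y) ||
            Nat.ble (nonDivisorBound N x y H) m))

theorem prime_of_isSmallPrime {p : ℕ} (h : isSmallPrime p = true) : p.Prime := by
  simp only [isSmallPrime, Bool.and_eq_true] at h
  obtain ⟨⟨h2, h840⟩, hall⟩ := h
  have h2 : 2 ≤ p := Nat.le_of_ble_eq_true h2
  have h840 : p ≤ 840 := Nat.le_of_ble_eq_true h840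
  rw [Nat.prime_def_le_sqrt]
  refine ⟨h2, fun m hm hms hmp => ?_⟩
  have hsq : m * m ≤ p := Nat.le_sqrt.mp hms
  have hm29 : m < 29 := by nlinarith
  have hlt : m < p := by nlinarith
  obtain ⟨d, rfl⟩ : ∃ d, m = d + 2 := ⟨m - 2, by omega⟩
  have hd := allLe_apply hall (d := d) (by omega)
  have hmod : p % (d + 2) = 0 := Nat.mod_eq_zero_of_dvd hmp
  simp only [Bool.or_eq_true, Bool.not_eq_true'] at hd
  rcases hd with hd | hd
  · have : p ≤ d + 2 := Nat.le_of_ble_eq_true hd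
    omega
  · have h0 : Nat.beq (p % (d + 2)) 0 = false := hd
    rw [hmod] at h0
    cases h0

theorem prime_of_fewNonDivisors {N m : ℕ} {H : List ℕ} (h : fewNonDivisors N m H = true) :
    ∀ q ∈ H, q.Prime := by
  rw [fewNonDivisors, Bool.and_eq_true] at h
  exact fun q hq => prime_of_isSmallPrime (List.all_eq_true.mp h.1 q hq)

theorem countP_not_dvd_le_nonDivisorBound {N x y : ℕ} :
    ∀ {H : List ℕ}, (∀ q ∈ H, q.Prime) →
      H.countP (fun q => ¬ q ∣ N.choose x * (N - x).choose y) ≤ nonDivisorBound N x y H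
  | [], _ => le_rfl
  | q :: H, hH => by
    have ih := countP_not_dvd_le_nonDivisorBound (N := N) (x := x) (y := y)
      fun r hr => hH r (List.mem_cons_of_mem q hr)
    have hq := hH q List.mem_cons_self
    rw [List.countP_cons, nonDivisorBound]
    by_cases hd : q ∣ N.choose x * (N - x).choose y
    · simp only [hd, not_true_eq_false, decide_false, Bool.false_eq_true, if_false, Nat.add_zero]
      cases digitsLe q 10 N x && digitsLe q 10 (Nat.sub N x) y
      · exact ih
      · exact ih.trans (Nat.le_succ _)
    · have h1 : digitsLe q 10 N x = true :=
        digitsLe_of_not_dvd_choose hq fun h => hd (h.mul_right _)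
      have h2 : digitsLe q 10 (Nat.sub N x) y = true :=
        digitsLe_of_not_dvd_choose hq fun h => hd (Dvd.dvd.mul_left h _)
      simp only [hd, h1, h2, not_false_eq_true, decide_true, if_true, Bool.and_self, cond_true]
      exact Nat.succ_le_succ ih

/-- Either all entries after the first `m` divide `c`, leaving at most `m` others, or one of them
does not, and then the search for that prime has met the parts of `c`. -/
theorem countP_not_dvd_le {N m c : ℕ} {H : List ℕ} (hN : N < 2 ^ 10)
    (h : fewNonDivisors N m H = true) (hc : IsProperNomialCoeff 3 N c) :
    H.countP (fun q => ¬ q ∣ c) ≤ m := by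
  obtain ⟨x, y, hx, hxy, hyz, rfl⟩ := exists_sorted_of_isProperNomialCoeff_three hc
  have hprime := prime_of_fewNonDivisors h
  rw [fewNonDivisors, Bool.and_eq_true] at h
  have h := List.all_eq_true.mp h.2
  by_cases hall : ∀ p ∈ H.drop m, p ∣ N.choose x * (N - x).choose y
  · have h0 : (H.drop m).countP (fun q => ¬ q ∣ N.choose x * (N - x).choose y) = 0 := by
      rw [List.countP_eq_zero]
      intro p hp
      simpa using hall p hp
    rw [← List.take_append_drop m H, List.countP_append, h0]
    exact List.countP_le_length.trans (List.length_take_le m H)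
  · push Not at hall
    obtain ⟨p, hp, hpd⟩ := hall
    have hpp := hprime p (List.mem_of_mem_drop hp)
    have h1 := apply_of_allDigitsLe hpp hN (h p hp) fun hd => hpd (hd.mul_right _)
    have hx0 : Nat.beq x 0 = false := by
      cases x with
      | zero => omega
      | succ x => rfl
    -- The parts are sorted, so the branches pruned in the search, here and for `y` below, never
    -- contain them.
    have hx3 : Nat.blt N (Nat.mul 3 x) = false := by
      by_contra hcon
      have : N < 3 * x := Nat.le_of_ble_eq_true (by simpa using hcon)
      omega
    rw [applyStrict_eq, hx0, hx3, Bool.false_or, Bool.false_or] at h1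
    have h2 := apply_of_allDigitsLe hpp ((Nat.sub_le N x).trans_lt hN) h1
      fun hd => hpd (Dvd.dvd.mul_left hd _)
    have hy : Nat.blt y x = false := by
      by_contra hcon
      have : y < x := Nat.le_of_ble_eq_true (by simpa using hcon)
      omega
    have hy2 : Nat.blt (Nat.sub N x) (Nat.mul 2 y) = false := by
      by_contra hcon
      have : N - x < 2 * y := Nat.le_of_ble_eq_true (by simpa using hcon)
      omega
    rw [applyStrict_eq, hy, hy2, Bool.false_or, Bool.false_or] at h2
    exact (countP_not_dvd_le_nonDivisorBound hprime).trans (Nat.le_of_ble_eq_true h2)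

/-! ### Pigeonhole over three coefficients -/

/-- If a nonempty list of primes is such that every proper trinomial coefficient of weight `N` is
divisible by more than two thirds of them, then any three have a common prime divisor. -/
theorem not_isWassermanCounterexample_of_fewNonDivisors {N m : ℕ} {H : List ℕ} (hN : N < 2 ^ 10)
    (h : fewNonDivisors N m H = true) (hm : 3 * m < H.length) (c : Fin 3 → ℕ) :
    ¬ IsWassermanCounterexample 3 N c := by
  rintro ⟨hc, hd⟩
  have hprime := prime_of_fewNonDivisors h
  -- Union bound: if each entry is missed by some coefficient, the three miss counts add up to at
  -- least the length.
  have hcover : ∀ L : List ℕ, (∀ q ∈ L, ∃ j, ¬ q ∣ c j) →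
      L.length ≤ ∑ j, L.countP (fun q => ¬ q ∣ c j) := by
    intro L
    induction L with
    | nil => simp
    | cons q L ih =>
      intro hL
      have h1 := ih fun r hr => hL r (List.mem_cons_of_mem q hr)
      obtain ⟨j, hj⟩ := hL q List.mem_cons_self
      simp only [List.countP_cons, Finset.sum_add_distrib, List.length_cons]
      have h2 : 1 ≤ ∑ i, if decide (¬ q ∣ c i) = true then 1 else 0 := by
        refine le_trans ?_ (Finset.single_le_sum (fun _ _ => Nat.zero_le _) (Finset.mem_univ j))
        simp [hj]
      exact Nat.add_le_add h1 h2
  have h1 := hcover H fun q hq => by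
    by_contra! hcon
    exact hd ⟨q, (hprime q hq).one_lt, hcon⟩
  have h2 : ∑ j, H.countP (fun q => ¬ q ∣ c j) ≤ ∑ _j : Fin 3, m :=
    Finset.sum_le_sum fun j _ => countP_not_dvd_le hN h (hc j)
  simp only [Finset.sum_const, Finset.card_univ, Fintype.card_fin, smul_eq_mul] at h2
  omega

/-! ### The certificate and its verification -/

/-- For each weight below 785, a list of primes such that every proper trinomial coefficient of
that weight is divisible by more than two thirds of them. -/
def dividingPrimes : List (List ℕ) :=
  [
    -- A single prime `p` suffices when the base `p` digit sum of the weight is at most 2: no three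
    -- positive parts add up without a carry. Four primes allow one miss per coefficient.
    [2], [2], [2], [3], [3], [5], [5], [7], [7], [3], [5], [11], [11], [13], [13], [3,7,13,5], [2],
    [17], [17], [19], [19], [2,3,19,7], [11], [23], [23], [5], [13], [3], [3], [29], [29], [31],
    [31], [2], [17], [2,7,5,17], [3], [37], [37], [3,19,37,13], [2], [41], [41], [43], [43],
    [5,11,3,43], [23], [47], [47], [7], [7], [2,5,7,17], [7,17,2,13], [53], [53], [11,3,5,53], [7],
    [53,7,3,19], [29], [59], [59], [61], [61], [3,7,31,61], [2], [2], [2], [67], [67], [17,2,67,23],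
    [7,23,67,2], [71], [71], [73], [73], [2,37,73,5], [5,73,2,19], [7,19,73,11], [11,2,73,13], [79],
    [79], [3], [41], [83], [83], [5,3,17,83], [43], [83,3,43,29], [11,43,29,2], [89], [89],
    [7,13,3,89], [13,2,89,23], [23,89,3,31], [47], [5,31,19,47], [2], [97], [97], [11,3,7,97],
    [3,97,2,5], [101], [101], [103], [103], [2,5,7,103], [53], [107], [107], [109], [109],
    [11,3,109,37], [7,37,109,2], [113], [113], [5,19,23,113], [2,23,113,29], [13,29,113,3], [59],
    [113,7,17,59], [17,2,3,59], [11], [61], [3,11,61,41], [2,11,41,31], [5], [5], [127], [127], [2],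
    [5], [131], [131], [19,2,11,131], [67], [131,3,5,67], [2], [137], [137], [139], [139],
    [5,2,139,47], [71], [13,139,11,71], [2], [71,5,2,29], [73], [29,2,73,7], [73,7,2,37], [149],
    [149], [151], [151], [3,2,17,151], [2,7,11,151], [7,151,5,31], [2,5,31,151], [157], [157],
    [3,79,157,53], [2], [7,157,23,2], [3], [163], [163], [11,41,3,163], [83], [167], [167], [13],
    [13], [17,19,3,13], [2,3,13,43], [173], [173], [7,29,5,173], [11,5,173,2], [3,2,173,59], [89],
    [179], [179], [181], [181], [3,13,181,61], [2,23,61,181], [23,5,181,37], [3,37,181,31],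
    [11,31,181,17], [2,17,181,47], [7,181,47,3], [5,47,19,3], [191], [191], [193], [193],
    [2,13,97,193], [13,193,2,7], [197], [197], [199], [199], [5,2,199,67], [101], [7,199,29,101],
    [29,17,2,101], [2,5,101,41], [103], [41,3,23,103], [23,103,13,2], [13,2,19,103], [5,7,103,2],
    [211], [211], [2,53,211,71], [107], [5,211,43,107], [2,43,3,107], [7,3,211,31], [109],
    [211,3,109,73], [2,11,109,73], [11,17,73,13], [3,13,109,37], [223], [223], [3,2,5,223], [113],
    [227], [227], [229], [229], [7,11,23,229], [11,2,29,229], [233], [233], [5,13,47,233],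
    [2,47,233,59], [3,59,233,79], [7,17,233,79], [239], [239], [241], [241], [3], [3], [5,61,7,3],
    [3], [19,13,41,3], [13,2,3,31], [7,31,3,83], [5], [251], [251], [23,3,11,251], [127],
    [251,3,5,127], [2], [257], [257], [43,37,2,257], [2], [29,257,2,3], [131], [263], [263],
    [5,2,53,263], [19,53,263,2], [53,3,2,89], [263,89,2,67], [269], [269], [271], [271],
    [13,2,3,271], [137], [11,271,5,137], [3,5,137,2], [277], [277], [31,3,139,277], [3,5,277,2],
    [281], [281], [283], [283], [19,5,71,283], [2,13,11,283], [13,11,283,41], [2], [17], [17],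
    [3,2,17,97], [17,97,2,73], [293], [293], [2,7,59,293], [59,37,293,2], [11,2,293,3], [149],
    [13,23,293,149], [2,3,5,149], [293,5,7,43], [151], [43,3,151,101], [19,151,101,2], [5,2,101,61],
    [17], [307], [307], [2,3,307,103], [5,31,103,307], [311], [311], [313], [313], [7,3,157,313],
    [3,2,313,79], [317], [317], [11,53,29,317], [2], [3,317,2,107], [23,317,107,2], [19,2,107,17],
    [3], [17,2,5,3], [163], [317,3,163,109], [41,163,109,2], [41,2,109,47], [47,163,2,3], [331],
    [331], [37,83,3,331], [167], [5,331,67,167], [3,67,167,2], [337], [337], [3,13,337,113],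
    [2,17,113,337], [2,17,31,337], [31,19,337,3], [7], [7], [3,23,43,7], [173], [347], [347], [349],
    [349], [3,7,13,349], [3,13,349,2], [353], [353], [2,59,71,353], [2,71,353,89], [17,89,353,7],
    [179], [359], [359], [19], [181], [3,19,181,11], [13,7,11,19], [13,7,19,73], [3,19,73,61],
    [367], [367], [2,3,41,367], [2,41,37,367], [37,7,367,53], [7,53,31,367], [373], [373],
    [17,11,373,5], [2,47,5,373], [47,29,13,373], [13,7,373,3], [379], [379], [5,19,379,127], [191],
    [383], [383], [5,11,2,383], [193], [3,43,383,193], [43,193,2,97], [389], [389], [2,23,17,389],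
    [7], [2,389,7,131], [197], [5,131,79,197], [11,2,79,197], [397], [397], [7,19,199,397],
    [19,5,397,2], [401], [401], [13,31,67,401], [31,2,401,101], [5,101,401,3], [29,401,3,7],
    [7,11,401,37], [17,401,2,3], [409], [409], [41,3,409,137], [2,137,409,103], [7,103,409,59],
    [23,59,409,3], [5,3,409,83], [13,409,83,2], [3,83,2,139], [409,2,19,139], [419], [419], [421],
    [421], [3,47,211,421], [47,2,53,421], [17,53,5,421], [2,5,421,71], [7,71,421,61],
    [2,61,421,107], [11,13,421,107], [13,5,107,43], [431], [431], [433], [433], [5,3,29,433],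
    [29,2,433,109], [23,19,109,433], [3,19,433,73], [439], [439], [2,3,7,439], [13,17,7,439], [443],
    [443], [5,37,89,443], [223], [3,443,223,149], [7,223,149,2], [449], [449], [5,2,41,449],
    [41,2,449,113], [2,113,449,151], [227], [5,7,151,227], [7,2,19,227], [457], [457],
    [17,3,229,457], [3,2,23,457], [461], [461], [463], [463], [29,2,31,463], [233], [467], [467],
    [2,7,67,467], [2,67,47,467], [3,47,467,157], [2,467,59,157], [11,59,43,157], [2,43,467,79],
    [5,467,19,79], [7,19,17,467], [17,3,467,53], [239], [479], [479], [13,2,37,479], [241],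
    [7,23,479,241], [23,2,241,11], [5,479,11,97], [3], [487], [487], [61,3,487,163], [3,7,163,487],
    [491], [491], [17,29,3,491], [13,29,19,491], [19,11,491,3], [31,11,491,3], [31,7,491,71],
    [71,491,3,83], [499], [499], [3,5,499,167], [251], [503], [503], [3,5,101,503], [5,11,101,503],
    [11,3,503,13], [3,101,13,127], [509], [509], [7,5,73,509], [2], [2], [257], [3,2,103,257], [2],
    [11,47,257,2], [47,37,257,2], [37,3,2,173], [2], [521], [521], [523], [523], [2,5,131,523],
    [263], [5,2,31,263], [2], [23], [23], [3,2,59,23], [19,59,23,2], [41,2,13,23], [13,2,23,89],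
    [5,23,89,107], [23,107,67,2], [67,107,2,179], [269], [2,179,7,269], [7,2,3,269], [541], [541],
    [3,271,541,181], [2], [5,541,2,109], [13,109,541,2], [547], [547], [2,61,137,547], [61,5,2,547],
    [5,29,19,547], [23], [547,2,79,23], [277], [2,79,37,277], [37,2,277,139], [557], [557],
    [31,13,43,557], [7,43,557,2], [11,17,2,557], [281], [563], [563], [47,2,113,563], [283],
    [7,563,3,283], [2,3,71,283], [569], [569], [571], [571], [13,3,571,191], [2,41,191,571],
    [41,5,571,23], [2], [577], [577], [2,17,577,193], [29,193,577,2], [29,2,577,83], [83,2,577,97],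
    [2,83,97,53], [53,577,73,2], [73,577,3,2], [293], [587], [587], [2,31,7,587], [31,2,59,587],
    [3,59,587,197], [37,587,197,2], [593], [593], [7,3,17,593], [2,17,593,149], [3,149,593,199],
    [2,593,23,199], [599], [599], [601], [601], [43,3,67,601], [2,67,601,151], [5,151,601,11],
    [3,11,601,101], [607], [607], [7,29,2,607], [29,2,61,607], [13,61,47,607], [47,2,607,17], [613],
    [613], [2,41,307,613], [41,2,11,613], [617], [617], [619], [619], [31,3,23,619], [311],
    [7,619,89,311], [3,89,2,311], [5], [313], [19,11,5,313], [11,2,5,157], [37,17,5,157], [5],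
    [631], [631], [2,79,631,211], [317], [631,127,5,317], [53,127,5,317], [13,53,7,631],
    [29,7,11,317], [3,11,317,71], [2], [641], [641], [643], [643], [43,2,5,643], [5,17,2,643],
    [647], [647], [3,2,59,647], [5], [31,3,647,5], [3,2,5,163], [653], [653], [109,5,131,653],
    [5,131,653,2], [3,2,73,653], [73,47,2,653], [659], [659], [661], [661], [3,17,331,661],
    [17,2,83,661], [2,83,5,661], [2,3,37,661], [37,29,23,661], [23,2,661,167], [3,661,167,223],
    [5,167,67,223], [5,67,61,223], [3,61,223,2], [673], [673], [3,5,337,673], [2,5,673,13], [677],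
    [677], [2,113,97,677], [97,2,5,677], [2,5,677,227], [31,2,677,227], [683], [683], [2,5,137,683],
    [7], [3,683,7,229], [43,2,7,229], [2,53,7,13], [5,13,23,7], [691], [691], [3,173,7,691], [347],
    -- Repeated entries act as weights: in a list of length seven each coefficient may miss total
    -- weight 2.
    [5,691,139,347], [29,2,139,347], [2,17,41,347], [349], [2,41,691,349,349,233,233],
    [7,349,5,233], [701], [701], [19,13,37,701], [11,37,701,2], [47,5,2,701], [353],
    [701,7,101,353], [101,59,2,353], [709], [709], [5,71,79,709], [79,2,89,709], [2,23,89,709],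
    [17,2,7,709], [5,7,13,709], [13,2,709,179], [13,2,701,179,179,239,239], [359], [719], [719],
    [2,7,103,719], [19], [2,103,19,241], [2,19,241,181], [29,241,5,181], [2,5,19,11], [727], [727],
    [3], [3], [17,73,43,3], [3], [733], [733], [3,7,367,733], [2,3,7,733], [2,11,67,733], [3],
    [739], [739], [13,3,19,739], [3,7,19,739], [743], [743], [5,3,149,743], [373], [83,743,3,373],
    [11,83,3,373], [11,7,743,107], [5], [751], [751], [47,3,751,251], [29,3,251,751],
    [29,751,5,151], [3], [757], [757], [23,3,379,757], [3,5,19,757], [761], [761], [3,127,109,761],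
    [7,109,761,191], [5,191,761,3], [383], [13,59,761,383], [2], [769], [769], [3,2,769,257],
    [257,769,2,193], [773], [773], [2,3,5,773], [5,97,773,2], [3,97,2,773], [389], [41,773,19,389],
    [19,2,5,389], [2,5,71,389], [2,23,71,389], [23,29,389,3], [389,3,7,2]]

/-- Checks the entries of a list of lists of primes, the first of which belongs to weight `N`. -/
def checkFrom : List (List ℕ) → ℕ → Bool
  | [], _ => true
  -- `(length - 1) / 3` is the largest `m` with `3 * m < length`; the comparison fails only for an
  -- empty list.
  | H :: t, N => Nat.blt (Nat.mul 3 (Nat.div (Nat.pred H.length) 3)) H.length &&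
      (fewNonDivisors N (Nat.div (Nat.pred H.length) 3) H &&
        applyStrict (checkFrom t) (Nat.succ N))

theorem exists_fewNonDivisors_of_checkFrom :
    ∀ {t : List (List ℕ)} {N i : ℕ}, checkFrom t N = true → i < t.length →
      ∃ m H, fewNonDivisors (N + i) m H = true ∧ 3 * m < H.length
  | [], _, _, _, hi => absurd hi (Nat.not_lt_zero _)
  | H :: t, N, 0, h, _ => by
    simp only [checkFrom, Bool.and_eq_true] at h
    exact ⟨_, H, h.2.1, Nat.le_of_ble_eq_true h.1⟩
  | H :: t, N, i + 1, h, hi => by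
    simp only [checkFrom, Bool.and_eq_true, applyStrict_eq] at h
    obtain ⟨m, H', h1, h2⟩ := exists_fewNonDivisors_of_checkFrom h.2.2 (Nat.lt_of_succ_lt_succ hi)
    refine ⟨m, H', ?_, h2⟩
    rwa [Nat.succ_add_eq_add_succ] at h1

theorem checkFrom_dividingPrimes : checkFrom dividingPrimes 0 = true := by
  decide +kernel

theorem proposition14 (N : ℕ) (hN : N < 785) :
    ¬ ∃ c : Fin 3 → ℕ, IsWassermanCounterexample 3 N c := by
  rintro ⟨c, hc⟩
  obtain ⟨m, H, h1, h2⟩ := exists_fewNonDivisors_of_checkFrom (i := N) checkFrom_dividingPrimes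
    (lt_of_lt_of_eq hN (by decide +kernel))
  rw [Nat.zero_add] at h1
  exact not_isWassermanCounterexample_of_fewNonDivisors (by omega) h1 h2 c hc
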